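/- Let $\mathbb K$ be a field. All polynomial rings below are polynomial rings $S=\mathbb K[X_1,\dots,X_n]$ over $\mathbb K$ in finitely many variables ($n\ge 0$), with their $\mathbb N^n$-grading; a \emph{monomial ideal} is an ideal generated by monomials. For a finitely generated multigraded $S$-module $M$, let $\operatorname{depth}_S M$ be the largest length of an $M$-regular sequence contained in $(X_1,\dots,X_n)$. A \emph{Stanley decomposition} of $M$ is a finite family of pairs $(\lambda_i,Z_i)$, $i\in\mathcal I$, with $\lambda_i\in M$ homogeneous and $Z_i\subseteq\{X_1,\dots,X_n\}$, such that each $\lambda_i\mathbb K[Z_i]\subseteq M$ is a free $\mathbb K[Z_i]$-module with basis $\lambda_i$ and $M=\bigoplus_{i\in\mathcal I}\lambda_i\mathbb K[Z_i]$ as a $\mathbb K$-vector space. Its depth is $\min_{i}|Z_i|$ (which is $\infty$ for the empty decomposition of $M=0$), and $\operatorname{sdepth}_S M$ is the maximal depth of a Stanley decomposition of $M$. \emph{The Stanley conjecture holds for $M$} if $\operatorname{sdepth}_S M\ge\operatorname{depth}_S M$ (so it holds for $M=0$). For a set $A$ of variables of $S$, let $S_A$ be the polynomial ring over $\mathbb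 K$ in the variables not in $A$, and for a monomial ideal $I\subseteq S$ let $I_A := I\,S[X^{-1}: X\in A]\cap S_A$. The quotients $S_A/I_A$, where $A$ ranges over all sets of variables, are the \emph{monomial localizations} of $S/I$. Let $\pi_A:S\to S_A$ be the $\mathbb K$-algebra homomorphism which sends every variable in $A$ to $1$ and every other variable to itself. \textbf{Theorem.} (a) The following are equivalent: \begin{enumerate} \item The Stanley conjecture holds for $S/I$, for every polynomial ring $S$ and every monomial ideal $I\subseteq S$. \item For every polynomial ring $S$ and every monomial ideal $I\subseteq S$: if the Stanley conjecture holds for the $S$-module $S/I$, then it holds for every monomial localization $S_A/I_A$ of $S/I$ (as an $S_A$-module). \end{enumerate} (b) The following are equivalent: \begin{enumerate} \item The Stanley conjecture holds for $I$, for every polynomial ring $S$ and every monomial ideal $I\subseteq S$. \item For every polynomial ring $S$ and every monomial ideal $I\subseteq S$: if the Stanley conjecture holds for the $S$-module $I$, then for every set $A$ of variables it holds for the ideal $\pi_A(I)\subseteq S_A$ (as an $S_A$-module). \end{enumerate} -/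

import Mathlib

namespace StanleyConj

noncomputable section

/-! `MvPolynomial σ K`, with `σ` finite, is the polynomial ring `S`; the monomials are the
elements `monomial d 1`, `d : σ →₀ ℕ`. -/

/-- A monomial ideal: an ideal generated by a set of monomials. -/
def IsMonomialIdeal {K : Type*} [Field K] {σ : Type*} (I : Ideal (MvPolynomial σ K)) : Prop :=
  ∃ s : Set (σ →₀ ℕ), I = Ideal.span ((fun d => MvPolynomial.monomial d (1 : K)) '' s)

/-- The multigraded component of degree `d` of the polynomial ring: the `K`-multiples of the
monomial `X ^ d`. -/
def ringComponent (K : Type*) [Field K] {σ : Type*} (d : σ →₀ ℕ) :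
    Submodule K (MvPolynomial σ K) :=
  Submodule.span K {MvPolynomial.monomial d (1 : K)}

/-- The multigraded component of degree `d` of an ideal `I`, viewed as a module. -/
def idealComponent {K : Type*} [Field K] {σ : Type*} (I : Ideal (MvPolynomial σ K))
    (d : σ →₀ ℕ) : Submodule K I :=
  (ringComponent K d).comap (I.subtype.restrictScalars K)

/-- The multigraded component of degree `d` of the quotient `S / I`. -/
def quotComponent {K : Type*} [Field K] {σ : Type*} (I : Ideal (MvPolynomial σ K))
    (d : σ →₀ ℕ) : Submodule K (MvPolynomial σ K ⧸ I) :=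
  (ringComponent K d).map (I.mkQ.restrictScalars K)

/-- The `K`-subspace `l K[Z]` of an `S`-module `M`, for `l ∈ M` and a set `Z` of variables. -/
def stanleySpace (K : Type*) [Field K] {σ : Type*} {M : Type*} [AddCommGroup M] [Module K M]
    [Module (MvPolynomial σ K) M] [IsScalarTower K (MvPolynomial σ K) M]
    (Z : Finset σ) (l : M) : Submodule K M :=
  (Subalgebra.toSubmodule (MvPolynomial.supported K (Z : Set σ))).map
    ((LinearMap.toSpanSingleton (MvPolynomial σ K) M l).restrictScalars K)

/-- A Stanley decomposition of the module `M` with multigraded components `𝓜 d`: a finite family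
of homogeneous elements `gen i` and sets of variables `Z i` such that every `K[Z i]`-module
`gen i K[Z i]` is free with basis `gen i`, and `M` is the (internal) direct sum of these spaces. -/
structure StanleyDecomposition {K : Type*} [Field K] {σ : Type*} {M : Type*} [AddCommGroup M]
    [Module K M] [Module (MvPolynomial σ K) M] [IsScalarTower K (MvPolynomial σ K) M]
    (𝓜 : (σ →₀ ℕ) → Submodule K M) where
  /-- the number of Stanley spaces -/
  r : ℕ
  /-- the sets of variables -/
  Z : Fin r → Finset σ
  /-- the homogeneous generators -/
  gen : Fin r → M
  homogeneous : ∀ i, ∃ d, gen i ∈ 𝓜 d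
  free : ∀ i, ∀ p ∈ MvPolynomial.supported K (Z i : Set σ), p • gen i = 0 → p = 0
  isInternal : DirectSum.IsInternal fun i => stanleySpace K (Z i) (gen i)

/-- The depth of a Stanley decomposition, that is, of the module `⨁ i, gen i K[Z i]`: the least
number of variables in one of the sets `Z i` (it is `⊤` for the empty decomposition of `0`). -/
def StanleyDecomposition.depth {K : Type*} [Field K] {σ : Type*} {M : Type*} [AddCommGroup M]
    [Module K M] [Module (MvPolynomial σ K) M] [IsScalarTower K (MvPolynomial σ K) M]
    {𝓜 : (σ →₀ ℕ) → Submodule K M} (D : StanleyDecomposition 𝓜) : ℕ∞ :=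
  ⨅ i : Fin D.r, ((D.Z i).card : ℕ∞)

/-- The Stanley depth of a multigraded module: the largest depth of a Stanley decomposition. -/
def stanleyDepth {K : Type*} [Field K] {σ : Type*} {M : Type*} [AddCommGroup M]
    [Module K M] [Module (MvPolynomial σ K) M] [IsScalarTower K (MvPolynomial σ K) M]
    (𝓜 : (σ →₀ ℕ) → Submodule K M) : ℕ∞ :=
  ⨆ D : StanleyDecomposition 𝓜, D.depth

/-- The depth of a module `M` over the polynomial ring `S` (with respect to the graded maximal
ideal, generated by the variables): the largest length of an `M`-regular sequence in that ideal. -/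
def depth (K : Type*) [Field K] (σ : Type*) (M : Type*) [AddCommGroup M]
    [Module (MvPolynomial σ K) M] : ℕ∞ :=
  ⨆ (rs : List (MvPolynomial σ K)) (_ : ∀ f ∈ rs, f ∈ MvPolynomial.idealOfVars σ K)
    (_ : RingTheory.Sequence.IsRegular M rs), (rs.length : ℕ∞)

/-- The Stanley conjecture holds for the module `S / I`. -/
def HoldsForQuotient {K : Type*} [Field K] {σ : Type*} (I : Ideal (MvPolynomial σ K)) : Prop :=
  depth K σ (MvPolynomial σ K ⧸ I) ≤ stanleyDepth (quotComponent I)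

/-- The Stanley conjecture holds for the module `I`. -/
def HoldsForIdeal {K : Type*} [Field K] {σ : Type*} (I : Ideal (MvPolynomial σ K)) : Prop :=
  depth K σ I ≤ stanleyDepth (idealComponent I)

/-- The `K`-algebra homomorphism to the polynomial ring in the variables outside `A` which sends
the variables in `A` to `1` and every other variable to itself. -/
def setOne (K : Type*) [Field K] {σ : Type*} (A : Set σ) :
    MvPolynomial σ K →ₐ[K] MvPolynomial (Aᶜ : Set σ) K :=
  open Classical in
  MvPolynomial.aeval fun i =>
    if h : i ∈ A then 1 else MvPolynomial.X (⟨i, h⟩ : (Aᶜ : Set σ))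

/-- The multiplicative set generated by the variables in `A`. -/
def varPowers (K : Type*) [Field K] {σ : Type*} (A : Set σ) : Submonoid (MvPolynomial σ K) :=
  Submonoid.closure (MvPolynomial.X '' A)

/-- The monomial localization of `I` at the monomial prime ideal generated by the variables
outside `A`: invert the variables in `A` and contract the extension of `I` to the polynomial ring
in the remaining variables. For a monomial ideal `I` the result is the unique monomial ideal of
that ring with the same extension as `I`; the monomial localization of `S / I` is the quotient of
the polynomial ring in the variables outside `A` by this ideal. -/
def monomialLocalization {K : Type*} [Field K] {σ : Type*} (A : Set σ)
    (I : Ideal (MvPolynomial σ K)) : Ideal (MvPolynomial (Aᶜ : Set σ) K) :=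
  (I.map (algebraMap (MvPolynomial σ K) (Localization (varPowers K A)))).comap
    ((algebraMap (MvPolynomial σ K) (Localization (varPowers K A))).comp
      (MvPolynomial.rename (Subtype.val : (Aᶜ : Set σ) → σ)).toRingHom)

end

end StanleyConj

/-!
In both parts the first statement implies the second because `I_A` and `π_A(I)` are again monomial
ideals; in fact they coincide (`IsMonomialIdeal.monomialLocalization_eq`).

Conversely, every nonzero monomial ideal `I` of `S` is recovered from an ideal of `S[Y]` for which
the Stanley conjecture holds because its depth is as small as possible. Let `𝔫` be the ideal
generated by all variables of `S[Y]` and `J = 𝔫 I` (`varsMul`). Setting `Y = 1` turns `𝔫` into the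
unit ideal and `J` into `I` (`map_setOne_varsMul`). A generating monomial `f` of `I` of least degree
is not in `J`, while `𝔫 f ⊆ J` (`IsMonomialIdeal.exists_socle`). Hence `depth S[Y]/J = 0`
(`depth_quotient_eq_zero`), so the conjecture holds for `S[Y]/J`; and `depth J ≤ 1`
(`depth_ideal_le_one`), so it holds for `J` because a monomial ideal in at least one variable has
Stanley depth at least one (`IsMonomialIdeal.one_le_stanleyDepth`).

The zero ideal is not of the form treated above, but there the conjecture is true: the module `0` has
depth `0` in the convention used here, and `S` itself is a single Stanley space of dimension
`dim S ≥ depth S`.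

The ring obtained from `S[Y]` by setting `Y = 1` has the variables of `S` only up to a bijection, so
the invariance of depth and Stanley depth under renaming of variables is needed as well.
-/

namespace StanleyConj

open MvPolynomial RingTheory.Sequence
open scoped Pointwise

/-! ### Regular sequences -/

/-- Each member of a regular sequence lowers the dimension of the support by at least one. -/
theorem length_le_supportDim {R : Type*} [CommRing R] [IsNoetherianRing R] (rs : List R) :
    ∀ {M : Type*} [AddCommGroup M] [Module R M] [Module.Finite R M], IsRegular M rs →
      (rs.length : WithBot ℕ∞) ≤ Module.supportDim R M := by
  induction rs with
  | nil =>
    intro M _ _ _ h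
    have := h.nontrivial
    have : Nonempty (Module.support R M) := Module.nonempty_support_iff.mpr this |>.to_subtype
    simpa [Module.supportDim] using Order.krullDim_nonneg (α := Module.support R M)
  | cons x rs ih =>
    intro M _ _ _ h
    obtain ⟨h1, h2⟩ := (isRegular_cons_iff M x rs).mp h
    have h3 := Module.supportDim_quotSMulTop_succ_le_of_notMem_minimalPrimes (M := M) (x := x)
      fun p hp => h1.notMem_of_mem_minimalPrimes hp
    refine le_trans ?_ h3
    push_cast [List.length_cons]
    gcongr
    exact ih h2

theorem depth_le_card (K : Type*) [Field K] (σ : Type*) [Finite σ] (M : Type*) [AddCommGroup M]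
    [Module (MvPolynomial σ K) M] [Module.Finite (MvPolynomial σ K) M] :
    depth K σ M ≤ Nat.card σ := by
  refine iSup_le fun rs => iSup_le fun _ => iSup_le fun h => ?_
  have h1 := (length_le_supportDim rs h).trans (Module.supportDim_le_ringKrullDim _ M)
  rw [MvPolynomial.ringKrullDim_of_isNoetherianRing, ringKrullDim_eq_zero_of_field, zero_add] at h1
  exact_mod_cast h1

/-- A nonzero socle element `f` of `S / J` forces depth zero. -/
theorem depth_quotient_eq_zero {K : Type*} [Field K] {σ : Type*} {J : Ideal (MvPolynomial σ K)}
    {f : MvPolynomial σ K} (hf : f ∉ J) (hfJ : ∀ a ∈ idealOfVars σ K, a * f ∈ J) :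
    depth K σ (MvPolynomial σ K ⧸ J) = 0 := by
  refine le_antisymm (iSup_le fun rs => iSup_le fun hrs => iSup_le fun h => ?_) bot_le
  cases rs with
  | nil => simp
  | cons a rs =>
    refine absurd ?_ hf
    have h1 := ((isRegular_cons_iff _ a rs).mp h).1
    rw [← Ideal.Quotient.eq_zero_iff_mem]
    apply h1
    simp only [smul_zero]
    rw [← Ideal.Quotient.mk_eq_mk, ← Submodule.Quotient.mk_smul, Submodule.Quotient.mk_eq_zero]
    exact hfJ a (hrs a (by simp))

/-- If `S / J` has a nonzero socle element `f`, the ideal `J` has depth at most one: for a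
`J`-regular sequence `a, b, …` the element `a f` of `J` satisfies `b (a f) = a (b f) ∈ a J`, hence
lies in `a J`, and cancelling `a` gives `f ∈ J`. -/
theorem depth_ideal_le_one {K : Type*} [Field K] {σ : Type*} {J : Ideal (MvPolynomial σ K)}
    {f : MvPolynomial σ K} (hf : f ∉ J) (hfJ : ∀ a ∈ idealOfVars σ K, a * f ∈ J) :
    depth K σ J ≤ 1 := by
  refine iSup_le fun rs => iSup_le fun hrs => iSup_le fun h => ?_
  match rs, hrs, h with
  | [], _, _ => simp
  | [_], _, _ => simp
  | a :: b :: rs, hrs, h =>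
    refine absurd ?_ hf
    have hJ := h.nontrivial
    obtain ⟨h1, h2⟩ := (isRegular_cons_iff _ a _).mp h
    have h3 := ((isRegular_cons_iff _ b _).mp h2).1
    have ha : a ≠ 0 := by
      rintro rfl
      obtain ⟨x, hx⟩ := exists_ne (0 : J)
      exact hx (h1 (by simp))
    have haJ := hfJ a (hrs a (by simp))
    have hbJ := hfJ b (hrs b (by simp))
    have h4 : (Submodule.Quotient.mk (⟨a * f, haJ⟩ : J) : QuotSMulTop a J) = 0 := by
      apply h3
      simp only [smul_zero]
      rw [← Submodule.Quotient.mk_smul, Submodule.Quotient.mk_eq_zero]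
      have : b • (⟨a * f, haJ⟩ : J) = a • (⟨b * f, hbJ⟩ : J) := by
        ext1; simp only [SetLike.mk_smul_mk, smul_eq_mul]; ring
      rw [this]
      exact Submodule.smul_mem_pointwise_smul _ _ _ trivial
    rw [Submodule.Quotient.mk_eq_zero, Submodule.mem_smul_pointwise_iff_exists] at h4
    obtain ⟨j, -, hj⟩ := h4
    have : a * (j : MvPolynomial σ K) = a * f := congrArg Subtype.val hj
    rw [← mul_left_cancel₀ ha this]
    exact j.2

/-! ### Monomial ideals -/

theorem IsMonomialIdeal.mem_iff {K : Type*} [Field K] {σ : Type*} {I : Ideal (MvPolynomial σ K)}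
    (hI : IsMonomialIdeal I) {x : MvPolynomial σ K} :
    x ∈ I ↔ ∀ u ∈ x.support, monomial u (1 : K) ∈ I := by
  classical
  obtain ⟨s, rfl⟩ := hI
  simp only [mem_ideal_span_monomial_image, support_monomial, one_ne_zero, if_false,
    Finset.mem_singleton, forall_eq]

theorem IsMonomialIdeal.mul {K : Type*} [Field K] {σ : Type*} {I J : Ideal (MvPolynomial σ K)}
    (hI : IsMonomialIdeal I) (hJ : IsMonomialIdeal J) : IsMonomialIdeal (I * J) := by
  obtain ⟨s, rfl⟩ := hI
  obtain ⟨t, rfl⟩ := hJ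
  refine ⟨s + t, ?_⟩
  rw [Ideal.span_mul_span']
  congr 1
  ext p
  simp only [Set.mem_mul, Set.mem_image, Set.mem_add]
  constructor
  · rintro ⟨_, ⟨a, ha, rfl⟩, _, ⟨b, hb, rfl⟩, rfl⟩
    exact ⟨_, ⟨a, ha, b, hb, rfl⟩, by simp [monomial_mul]⟩
  · rintro ⟨_, ⟨a, ha, b, hb, rfl⟩, rfl⟩
    exact ⟨_, ⟨a, ha, rfl⟩, _, ⟨b, hb, rfl⟩, by simp [monomial_mul]⟩

theorem isMonomialIdeal_idealOfVars (K : Type*) [Field K] (σ : Type*) :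
    IsMonomialIdeal (idealOfVars σ K) := by
  refine ⟨Set.range fun i => Finsupp.single i 1, ?_⟩
  rw [← Set.range_comp]
  rfl

/-- An algebra homomorphism taking monomials to monomials takes monomial ideals to monomial
ideals. -/
theorem IsMonomialIdeal.map {K : Type*} [Field K] {σ τ : Type*} {I : Ideal (MvPolynomial σ K)}
    (hI : IsMonomialIdeal I) (φ : MvPolynomial σ K →ₐ[K] MvPolynomial τ K)
    (g : (σ →₀ ℕ) → (τ →₀ ℕ)) (hφ : ∀ d, φ (monomial d 1) = monomial (g d) 1) :
    IsMonomialIdeal (I.map φ) := by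
  obtain ⟨s, rfl⟩ := hI
  refine ⟨g '' s, ?_⟩
  rw [Ideal.map_span, Set.image_image, Set.image_image]
  simp only [hφ]

/-- A generating monomial `f` of least degree of a nonzero monomial ideal `J` is not in `𝔫 J`, so
it is a nonzero socle element of `S / 𝔫 J`. -/
theorem IsMonomialIdeal.exists_socle {K : Type*} [Field K] {σ : Type*}
    {J : Ideal (MvPolynomial σ K)} (hJ : IsMonomialIdeal J) (h0 : J ≠ ⊥) :
    ∃ f, f ∉ idealOfVars σ K * J ∧ ∀ a ∈ idealOfVars σ K, a * f ∈ idealOfVars σ K * J := by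
  classical
  let s : Set (σ →₀ ℕ) := {d | monomial d (1 : K) ∈ J}
  have hs : s.Nonempty := by
    obtain ⟨x, hx, hx0⟩ := Submodule.exists_mem_ne_zero_of_ne_bot h0
    obtain ⟨u, hu⟩ := support_nonempty.mpr hx0
    exact ⟨u, hJ.mem_iff.mp hx u hu⟩
  let d := Function.argminOn Finsupp.degree s hs
  have hd : d ∈ s := Function.argminOn_mem _ _ _
  refine ⟨monomial d 1, fun h => ?_, fun a ha => Ideal.mul_mem_mul ha hd⟩
  have hle : idealOfVars σ K * J ≤ idealOfVars σ K ^ (d.degree + 1) := by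
    rw [pow_succ']
    refine Ideal.mul_mono_right fun x hx => ?_
    rw [mem_pow_idealOfVars_iff]
    exact fun u hu => Function.argminOn_le Finsupp.degree s (hJ.mem_iff.mp hx u hu)
  have := (monomial_mem_pow_idealOfVars_iff _ d (one_ne_zero (α := K))).mp (hle h)
  omega

/-! ### Stanley decompositions -/

theorem rename_mem_supported {K : Type*} [Field K] {σ τ : Type*} (f : σ → τ) {s : Set σ}
    {p : MvPolynomial σ K} (hp : p ∈ supported K s) : rename f p ∈ supported K (f '' s) := by
  classical
  rw [mem_supported] at hp ⊢
  intro j hj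
  obtain ⟨i, hi, rfl⟩ := mem_vars_rename f p hj
  exact ⟨i, hp hi, rfl⟩

/-- Along an isomorphism of polynomial rings that renames the variables, a compatible graded
`K`-linear isomorphism of modules carries Stanley decompositions to Stanley decompositions. -/
theorem stanleyDepth_le_of_linearEquiv {K : Type*} [Field K] {σ τ : Type*} (e : σ ≃ τ)
    {M N : Type*} [AddCommGroup M] [Module K M] [Module (MvPolynomial σ K) M]
    [IsScalarTower K (MvPolynomial σ K) M] [AddCommGroup N] [Module K N]
    [Module (MvPolynomial τ K) N] [IsScalarTower K (MvPolynomial τ K) N]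
    {𝓜 : (σ →₀ ℕ) → Submodule K M} {𝓝 : (τ →₀ ℕ) → Submodule K N} (ψ : M ≃ₗ[K] N)
    (hψ : ∀ (p : MvPolynomial σ K) m, ψ (p • m) = rename e p • ψ m)
    (hdeg : ∀ d, ∀ m ∈ 𝓜 d, ψ m ∈ 𝓝 (d.mapDomain e)) :
    stanleyDepth 𝓜 ≤ stanleyDepth 𝓝 := by
  classical
  have hsupp : ∀ (Z : Finset σ) (p : MvPolynomial σ K),
      rename e p ∈ supported K (Z.map e.toEmbedding : Set τ) ↔ p ∈ supported K (Z : Set σ) := by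
    intro Z p
    rw [Finset.coe_map]
    refine ⟨fun h => ?_, rename_mem_supported e⟩
    have h' := rename_mem_supported e.symm h
    rwa [rename_rename, e.symm_comp_self, rename_id_apply, Equiv.coe_toEmbedding,
      e.symm_image_image] at h'
  have hsurj := (renameEquiv K e).surjective
  have hspace : ∀ (Z : Finset σ) (l : M),
      stanleySpace K (Z.map e.toEmbedding) (ψ l) = Submodule.orderIsoMapComap ψ (stanleySpace K Z l)
      := by
    intro Z l
    ext n
    simp only [stanleySpace, Submodule.mem_map, Subalgebra.mem_toSubmodule,
      LinearMap.coe_restrictScalars, LinearMap.toSpanSingleton_apply,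
      Submodule.orderIsoMapComap_apply, exists_exists_and_eq_and]
    constructor
    · rintro ⟨q, hq, rfl⟩
      obtain ⟨p, rfl⟩ := hsurj q
      exact ⟨p, (hsupp Z p).mp hq, hψ p l⟩
    · rintro ⟨p, hp, rfl⟩
      exact ⟨rename e p, (hsupp Z p).mpr hp, (hψ p l).symm⟩
  refine iSup_le fun D => ?_
  let D' : StanleyDecomposition 𝓝 :=
    { r := D.r
      Z := fun i => (D.Z i).map e.toEmbedding
      gen := fun i => ψ (D.gen i)
      homogeneous := fun i => (D.homogeneous i).elim fun d hd => ⟨_, hdeg d _ hd⟩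
      free := by
        intro i q hq h
        obtain ⟨p, rfl⟩ := hsurj q
        have h' : ψ (p • D.gen i) = 0 := (hψ p _).trans h
        rw [D.free i p ((hsupp _ p).mp hq) (ψ.map_eq_zero_iff.mp h'), map_zero]
      isInternal := by
        obtain ⟨h1, h2⟩ :=
          (DirectSum.isInternal_submodule_iff_iSupIndep_and_iSup_eq_top _).mp D.isInternal
        refine DirectSum.isInternal_submodule_of_iSupIndep_of_iSup_eq_top ?_ ?_
        · simp only [hspace]
          exact (iSupIndep_map_orderIso_iff (Submodule.orderIsoMapComap ψ)).mpr h1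
        · simp only [hspace]
          rw [← OrderIso.map_iSup, h2, OrderIso.map_top] }
  have hD : D'.depth = D.depth := by simp [StanleyDecomposition.depth, D']
  exact hD ▸ le_iSup StanleyDecomposition.depth D'

/-- The exponents of the monomials of `X ^ c K[Z]`. -/
def orthant {σ : Type*} (Z : Finset σ) (c : σ →₀ ℕ) : Set (σ →₀ ℕ) :=
  {u | c ≤ u ∧ ∀ i ∉ Z, u i = c i}

theorem mem_stanleySpace_iff {K : Type*} [Field K] {σ : Type*} {I : Ideal (MvPolynomial σ K)}
    (Z : Finset σ) (c : σ →₀ ℕ) (hc : monomial c (1 : K) ∈ I) (x : I) :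
    x ∈ stanleySpace K Z (⟨monomial c 1, hc⟩ : I) ↔
      (x : MvPolynomial σ K) ∈ restrictSupport K (orthant Z c) := by
  classical
  simp only [stanleySpace, Submodule.mem_map, Subalgebra.mem_toSubmodule,
    LinearMap.coe_restrictScalars, LinearMap.toSpanSingleton_apply, mem_restrictSupport_iff]
  constructor
  · rintro ⟨p, hp, rfl⟩ u hu
    rw [mem_supported] at hp
    change u ∈ (p * monomial c 1).support at hu
    rw [mem_support_iff, coeff_mul_monomial'] at hu
    have hcu : c ≤ u := by by_contra h; simp [h] at hu
    refine ⟨hcu, fun i hi => ?_⟩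
    rw [if_pos hcu, mul_one, ← mem_support_iff] at hu
    have h0 : (u - c) i = 0 := by
      by_contra h
      exact hi (hp ((mem_vars_iff_mem_support i).mpr ⟨_, hu, Finsupp.mem_support_iff.mpr h⟩))
    have := hcu i
    rw [Finsupp.tsub_apply] at h0
    omega
  · intro h
    refine ⟨(x : MvPolynomial σ K).divMonomial c, ?_, ?_⟩
    · rw [mem_supported]
      intro i hi
      obtain ⟨d, hd, hid⟩ := (mem_vars_iff_mem_support i).mp hi
      rw [mem_support_iff, coeff_divMonomial, ← mem_support_iff] at hd
      by_contra hiZ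
      have := (h hd).2 i hiZ
      rw [Finsupp.add_apply] at this
      exact Finsupp.mem_support_iff.mp hid (by omega)
    · ext1
      ext u
      change coeff u (_ * monomial c 1) = _
      rw [coeff_mul_monomial', coeff_divMonomial, mul_one]
      split_ifs with hcu
      · rw [add_tsub_cancel_of_le hcu]
      · by_contra hu
        exact hcu (h (mem_support_iff.mpr (Ne.symm hu))).1

/-- A partition of the exponents of a monomial ideal into finitely many orthants is a Stanley
decomposition of the ideal. -/
theorem le_stanleyDepth_of_partition {K : Type*} [Field K] {σ : Type*}
    {I : Ideal (MvPolynomial σ K)} (hI : IsMonomialIdeal I) {ι : Type*} [Finite ι]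
    (Z : ι → Finset σ) (c : ι → σ →₀ ℕ)
    (hmem : ∀ u, monomial u (1 : K) ∈ I ↔ ∃ i, u ∈ orthant (Z i) (c i))
    (hdisj : ∀ i j u, u ∈ orthant (Z i) (c i) → u ∈ orthant (Z j) (c j) → i = j)
    {m : ℕ∞} (hm : ∀ i, m ≤ (Z i).card) : m ≤ stanleyDepth (idealComponent I) := by
  classical
  obtain ⟨r, ⟨e⟩⟩ := Finite.exists_equiv_fin ι
  have hc : ∀ i, monomial (c i) (1 : K) ∈ I := fun i => (hmem _).mpr ⟨i, le_rfl, fun _ _ => rfl⟩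
  let A : Fin r → Submodule K I :=
    fun i => stanleySpace K (Z (e.symm i)) (⟨monomial (c (e.symm i)) 1, hc _⟩ : I)
  have hA : ∀ i (x : I), x ∈ A i ↔
      (x : MvPolynomial σ K) ∈ restrictSupport K (orthant (Z (e.symm i)) (c (e.symm i))) :=
    fun i x => mem_stanleySpace_iff _ _ _ _
  let D : StanleyDecomposition (idealComponent I) :=
    { r := r
      Z := fun i => Z (e.symm i)
      gen := fun i => ⟨monomial (c (e.symm i)) 1, hc _⟩
      homogeneous := fun i => ⟨c (e.symm i), Submodule.mem_span_singleton_self _⟩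
      free := by
        intro i p _ h
        have h' : p * monomial (c (e.symm i)) (1 : K) = 0 := congrArg Subtype.val h
        exact (mul_eq_zero.mp h').resolve_right 
          (monomial_eq_zero.not.mpr (one_ne_zero (α := K)))
      isInternal := by
        refine DirectSum.isInternal_submodule_of_iSupIndep_of_iSup_eq_top (A := A) ?_ ?_
        · intro i
          let T : Set (σ →₀ ℕ) := {u | ∃ j, j ≠ i ∧ u ∈ orthant (Z (e.symm j)) (c (e.symm j))}
          have hT : (⨆ (j) (_ : j ≠ i), A j) ≤
              (restrictSupport K T).comap (I.subtype.restrictScalars K) := by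
            refine iSup_le fun j => iSup_le fun hj x hx => ?_
            rw [hA, mem_restrictSupport_iff] at hx
            rw [Submodule.mem_comap, mem_restrictSupport_iff]
            exact fun u hu => ⟨j, hj, hx hu⟩
          refine Disjoint.mono_right hT (Submodule.disjoint_def.mpr fun x hx hxT => ?_)
          rw [hA, mem_restrictSupport_iff] at hx
          rw [Submodule.mem_comap, mem_restrictSupport_iff] at hxT
          refine Subtype.ext (support_eq_empty.mp ?_)
          refine Finset.eq_empty_of_forall_notMem fun u hu => ?_
          obtain ⟨j, hj, huj⟩ := hxT hu
          exact hj (e.symm.injective (hdisj _ _ u huj (hx hu)))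
        · refine eq_top_iff.mpr fun x _ => ?_
          have hx := hI.mem_iff.mp x.2
          have hmon : ∀ u : (x : MvPolynomial σ K).support,
              monomial (u : σ →₀ ℕ) (coeff u (x : MvPolynomial σ K)) ∈ I := by
            intro u
            have := I.mul_mem_left (C (coeff u (x : MvPolynomial σ K))) (hx u u.2)
            rwa [C_mul_monomial, mul_one] at this
          have hsum : x = ∑ u : (x : MvPolynomial σ K).support, (⟨_, hmon u⟩ : I) := by
            ext1
            rw [Submodule.coe_sum]
            conv_lhs => rw [(x : MvPolynomial σ K).as_sum, ← Finset.sum_coe_sort]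
          rw [hsum]
          refine Submodule.sum_mem _ fun u _ => ?_
          obtain ⟨i, hi⟩ := (hmem u).mp (hx u u.2)
          refine Submodule.mem_iSup_of_mem (e i) ?_
          rw [hA, e.symm_apply_apply, mem_restrictSupport_iff]
          exact (Finset.coe_subset.mpr support_monomial_subset).trans (by simpa using hi) }
  exact (le_iInf fun i => hm (e.symm i)).trans (le_iSup StanleyDecomposition.depth D)

/-- A monomial ideal in at least one variable `y` has a Stanley decomposition all of whose pieces
have dimension at least one. Let `g` bound the exponents of a finite set of monomial generators.
Replacing each exponent `u i` by `min (u i) (g i)`, `i ≠ y`, does not affect membership in the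
ideal, and for each of the finitely many values of the truncation away from `y`, the `y`-exponents
which occur form an up-set of `ℕ`, which gives one orthant having `y` among its directions. -/
theorem IsMonomialIdeal.one_le_stanleyDepth {K : Type*} [Field K] {σ : Type*} [Finite σ]
    [Nonempty σ] {I : Ideal (MvPolynomial σ K)} (hI : IsMonomialIdeal I) :
    1 ≤ stanleyDepth (idealComponent I) := by
  classical
  have := Fintype.ofFinite σ
  obtain ⟨y⟩ := ‹Nonempty σ›
  obtain ⟨t, ht⟩ : ∃ t : Finset (σ →₀ ℕ), ∀ u, monomial u (1 : K) ∈ I ↔ ∃ d ∈ t, d ≤ u := by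
    obtain ⟨s, rfl⟩ := hI
    obtain ⟨s', hs', hspan⟩ := (Submodule.fg_span_iff_fg_span_finset_subset _).mp
      (IsNoetherian.noetherian (Ideal.span ((fun d => monomial d (1 : K)) '' s)))
    obtain ⟨t, -, rfl⟩ := Finset.subset_set_image_iff.mp hs'
    refine ⟨t, fun u => ?_⟩
    rw [Ideal.span, hspan, Finset.coe_image]
    change _ ∈ Ideal.span _ ↔ _
    simp [mem_ideal_span_monomial_image, support_monomial]
  let g : σ →₀ ℕ := t.sup id
  have hg : ∀ d ∈ t, d ≤ g := fun d hd => Finset.le_sup (f := id) hd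
  -- The truncation at `g` in the directions other than `y`, with `y`-exponent `k`.
  let tr : (σ →₀ ℕ) → ℕ → (σ →₀ ℕ) := fun u k => (u ⊓ g).update y k
  have htr_y : ∀ u k, tr u k y = k := fun u k => by simp [tr]
  have htr_ne : ∀ u k i, i ≠ y → tr u k i = min (u i) (g i) := fun u k i hi => by simp [tr, hi]
  have hmemtr : ∀ u, monomial u (1 : K) ∈ I ↔ monomial (tr u (u y)) (1 : K) ∈ I := by
    intro u
    rw [ht, ht]
    refine exists_congr fun d => and_congr_right fun hd => forall_congr' fun i => ?_
    have := hg d hd i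
    by_cases hi : i = y
    · rw [hi, htr_y]
    · rw [htr_ne _ _ _ hi]; omega
  -- The truncations which occur, normalised to have `y`-exponent `0`.
  let ι := {c : σ →₀ ℕ // c ≤ g ∧ c y = 0 ∧ ∃ k, monomial (c.update y k) (1 : K) ∈ I}
  have : Finite ι :=
    Set.Finite.subset (Set.finite_Iic g) (fun c (hc : c ≤ g ∧ _) => hc.1) |>.to_subtype
  let k : ι → ℕ := fun c => Nat.find c.2.2.2
  have hk : ∀ (c : ι) n, monomial (c.1.update y n) (1 : K) ∈ I ↔ k c ≤ n := by
    intro c n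
    refine ⟨fun h => Nat.find_min' c.2.2.2 h, fun h => ?_⟩
    obtain ⟨d, hd, hdk⟩ := (ht _).mp (Nat.find_spec c.2.2.2)
    refine (ht _).mpr ⟨d, hd, hdk.trans fun i => ?_⟩
    by_cases hi : i = y
    · rw [hi, Finsupp.update_apply, if_pos rfl, Finsupp.update_apply, if_pos rfl]; exact h
    · simp [hi]
  let Z : ι → Finset σ := fun c => insert y (Finset.univ.filter fun i => c.1 i = g i)
  have horth : ∀ (c : ι) u, u ∈ orthant (Z c) (c.1.update y (k c)) ↔
      tr u 0 = c.1 ∧ monomial u (1 : K) ∈ I := by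
    intro c u
    have key : tr u 0 = c.1 → (monomial u (1 : K) ∈ I ↔ k c ≤ u y) := by
      intro h
      rw [hmemtr, ← hk, ← h]
      simp only [tr, Finsupp.update_idem]
    constructor
    · rintro ⟨h1, h2⟩
      have h : tr u 0 = c.1 := by
        ext i
        by_cases hi : i = y
        · rw [hi, htr_y, c.2.2.1]
        · rw [htr_ne _ _ _ hi]
          have h1i := h1 i
          have h2i := h2 i
          have hci := c.2.1 i
          simp only [Finsupp.update_apply, hi, if_false, Z, Finset.mem_insert, Finset.mem_filter,
            Finset.mem_univ, true_and, false_or] at h1i h2i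
          by_cases hcg : c.1 i = g i
          · omega
          · have := h2i hcg; omega
      have h1y := h1 y
      simp only [Finsupp.update_apply, if_true] at h1y
      exact ⟨h, (key h).mpr h1y⟩
    · rintro ⟨h, hu⟩
      have hle := (key h).mp hu
      constructor
      · intro i
        by_cases hi : i = y
        · subst hi; simpa using hle
        · have := htr_ne u 0 i hi
          rw [h] at this
          simp only [Finsupp.update_apply, hi, if_false]
          omega
      · intro i hi
        simp only [Z, Finset.mem_insert, Finset.mem_filter, Finset.mem_univ, true_and,
          not_or] at hi
        have := htr_ne u 0 i hi.1
        rw [h] at this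
        have h3 := hi.2
        simp only [Finsupp.update_apply, hi.1, if_false]
        omega
  refine le_stanleyDepth_of_partition hI Z (fun c => c.1.update y (k c)) (fun u => ?_)
    (fun i j u hi hj => ?_) (fun c => ?_)
  · refine ⟨fun hu => ?_, fun ⟨c, hc⟩ => ((horth c u).mp hc).2⟩
    refine ⟨⟨tr u 0, fun i => ?_, htr_y u 0, u y, ?_⟩, (horth _ u).mpr ⟨rfl, hu⟩⟩
    · by_cases hi : i = y
      · rw [hi, htr_y]; exact Nat.zero_le _
      · rw [htr_ne _ _ _ hi]; exact min_le_right _ _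
    · rw [hmemtr] at hu
      simpa only [tr, Finsupp.update_idem] using hu
  · exact Subtype.ext (((horth i u).mp hi).1.symm.trans ((horth j u).mp hj).1)
  · exact_mod_cast Finset.card_pos.mpr ⟨y, Finset.mem_insert_self _ _⟩

/-- The polynomial ring is a single Stanley space. -/
theorem card_le_stanleyDepth_quotient_bot (K : Type*) [Field K] (σ : Type*) [Finite σ] :
    (Nat.card σ : ℕ∞) ≤ stanleyDepth (quotComponent (⊥ : Ideal (MvPolynomial σ K))) := by
  have := Fintype.ofFinite σ
  have htop : stanleySpace K (Finset.univ : Finset σ)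
      (Submodule.Quotient.mk 1 : MvPolynomial σ K ⧸ (⊥ : Ideal (MvPolynomial σ K))) = ⊤ := by
    refine eq_top_iff.mpr fun x _ => ?_
    obtain ⟨p, rfl⟩ := Submodule.Quotient.mk_surjective _ x
    refine ⟨p, by simp, ?_⟩
    rw [LinearMap.coe_restrictScalars, LinearMap.toSpanSingleton_apply,
      ← Submodule.Quotient.mk_smul, smul_eq_mul, mul_one]
  let D : StanleyDecomposition (quotComponent (⊥ : Ideal (MvPolynomial σ K))) :=
    { r := 1
      Z := fun _ => Finset.univ
      gen := fun _ => Submodule.Quotient.mk 1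
      homogeneous := fun _ => ⟨0, 1, Submodule.mem_span_singleton_self _, rfl⟩
      free := by
        intro _ p _ h
        rw [← Submodule.Quotient.mk_smul, Submodule.Quotient.mk_eq_zero] at h
        simpa using h
      isInternal := by
        refine DirectSum.isInternal_submodule_of_iSupIndep_of_iSup_eq_top
          (iSupIndep_subsingleton _) ?_
        rw [iSup_const, htop] }
  refine le_trans ?_ (le_iSup StanleyDecomposition.depth D)
  simp [StanleyDecomposition.depth, D]

/-! ### Renaming the variables -/

theorem depth_le_of_addEquiv {K : Type*} [Field K] {σ τ : Type*} (e : σ ≃ τ) {M N : Type*}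
    [AddCommGroup M] [Module (MvPolynomial σ K) M] [AddCommGroup N] [Module (MvPolynomial τ K) N]
    (ψ : M ≃+ N) (hψ : ∀ (p : MvPolynomial σ K) m, ψ (p • m) = rename e p • ψ m) :
    depth K σ M ≤ depth K τ N := by
  refine iSup_le fun rs => iSup_le fun hrs => iSup_le fun h => ?_
  have h' : IsRegular N (rs.map (rename e)) :=
    (AddEquiv.isRegular_congr (e := ψ) (List.forall₂_map_right_iff.mpr
      (List.forall₂_same.mpr fun r _ x => hψ r x))).mp h
  have hmem : ∀ f ∈ rs.map (rename e), f ∈ idealOfVars τ K := by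
    intro f hf
    obtain ⟨p, hp, rfl⟩ := List.mem_map.mp hf
    have hle : idealOfVars σ K ≤ (idealOfVars τ K).comap (rename e) := by
      rw [idealOfVars, Ideal.span_le]
      rintro _ ⟨i, rfl⟩
      simpa using Ideal.subset_span (Set.mem_range_self (e i))
    exact hle (hrs p hp)
  exact le_iSup_of_le (rs.map (rename e)) (le_iSup_of_le hmem (le_iSup_of_le h' (by simp)))

theorem rename_mem_ringComponent {K : Type*} [Field K] {σ τ : Type*} (e : σ ≃ τ) (d : σ →₀ ℕ)
    {p : MvPolynomial σ K} (hp : p ∈ ringComponent K d) :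
    rename e p ∈ ringComponent K (d.mapDomain e) := by
  obtain ⟨a, rfl⟩ := Submodule.mem_span_singleton.mp hp
  rw [map_smul, rename_monomial]
  exact Submodule.smul_mem _ _ (Submodule.mem_span_singleton_self _)

/-- Both sides of the inequality in the Stanley conjecture are invariant under an isomorphism of
graded modules which is semilinear over a renaming of the variables. -/
theorem depth_le_stanleyDepth_of_linearEquiv {K : Type*} [Field K] {σ τ : Type*} (e : σ ≃ τ)
    {M N : Type*} [AddCommGroup M] [Module K M] [Module (MvPolynomial σ K) M]
    [IsScalarTower K (MvPolynomial σ K) M] [AddCommGroup N] [Module K N]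
    [Module (MvPolynomial τ K) N] [IsScalarTower K (MvPolynomial τ K) N]
    {𝓜 : (σ →₀ ℕ) → Submodule K M} {𝓝 : (τ →₀ ℕ) → Submodule K N} (ψ : M ≃ₗ[K] N)
    (hψ : ∀ (p : MvPolynomial σ K) m, ψ (p • m) = rename e p • ψ m)
    (hdeg : ∀ d, ∀ n ∈ 𝓝 d, ψ.symm n ∈ 𝓜 (d.mapDomain e.symm))
    (h : depth K τ N ≤ stanleyDepth 𝓝) : depth K σ M ≤ stanleyDepth 𝓜 := by
  refine (depth_le_of_addEquiv e ψ.toAddEquiv hψ).trans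
    (h.trans (stanleyDepth_le_of_linearEquiv e.symm ψ.symm (fun q n => ?_) hdeg))
  rw [LinearEquiv.symm_apply_eq, hψ, LinearEquiv.apply_symm_apply, rename_rename,
    e.self_comp_symm, rename_id_apply]

theorem HoldsForQuotient.of_map_rename {K : Type*} [Field K] {σ τ : Type*} (e : σ ≃ τ)
    {I : Ideal (MvPolynomial σ K)} (h : HoldsForQuotient (I.map (rename (R := K) e))) :
    HoldsForQuotient I := by
  let ψ : (MvPolynomial σ K ⧸ I) ≃ₐ[K] (MvPolynomial τ K ⧸ I.map (rename (R := K) e)) :=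
    Ideal.quotientEquivAlg I _ (renameEquiv K e) rfl
  have hmk : ∀ p, ψ (Submodule.Quotient.mk p) = Submodule.Quotient.mk (rename e p) :=
    fun _ => rfl
  refine depth_le_stanleyDepth_of_linearEquiv e ψ.toLinearEquiv (fun p m => ?_) ?_ h
  · obtain ⟨q, rfl⟩ := Submodule.Quotient.mk_surjective _ m
    rw [← Submodule.Quotient.mk_smul, AlgEquiv.toLinearEquiv_apply, hmk,
      AlgEquiv.toLinearEquiv_apply, hmk, ← Submodule.Quotient.mk_smul, smul_eq_mul, map_mul,
      smul_eq_mul]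
  · rintro d _ ⟨q, hq, rfl⟩
    exact ⟨rename e.symm q, rename_mem_ringComponent e.symm d hq, rfl⟩

theorem HoldsForIdeal.of_map_rename {K : Type*} [Field K] {σ τ : Type*} (e : σ ≃ τ)
    {I : Ideal (MvPolynomial σ K)} (h : HoldsForIdeal (I.map (rename (R := K) e))) :
    HoldsForIdeal I := by
  have hI : Submodule.map (renameEquiv K e).toLinearEquiv.toLinearMap (I.restrictScalars K) =
      (I.map (rename (R := K) e)).restrictScalars K := by
    ext q
    change _ ↔ q ∈ I.map (renameEquiv K e)
    rw [Ideal.mem_map_of_equiv]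
    rfl
  let ψ : I ≃ₗ[K] I.map (rename (R := K) e) :=
    ((renameEquiv K e).toLinearEquiv.submoduleMap (I.restrictScalars K)).trans
      (LinearEquiv.ofEq _ _ hI)
  have hψ : ∀ p : I, (ψ p : MvPolynomial τ K) = rename e (p : MvPolynomial σ K) := fun _ => rfl
  refine depth_le_stanleyDepth_of_linearEquiv e ψ (fun p m => ?_) ?_ h
  · ext1
    rw [hψ, Submodule.coe_smul, Submodule.coe_smul, smul_eq_mul, map_mul, smul_eq_mul, hψ]
  · intro d n hn
    have := rename_mem_ringComponent e.symm d hn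
    obtain ⟨m, rfl⟩ := ψ.surjective n
    rw [LinearEquiv.symm_apply_apply]
    change (m : MvPolynomial σ K) ∈ ringComponent K _
    change rename e.symm (ψ m : MvPolynomial τ K) ∈ ringComponent K _ at this
    rwa [hψ, rename_rename, e.symm_comp_self, rename_id_apply] at this

/-! ### Monomial localization -/

theorem setOne_rename {K : Type*} [Field K] {σ : Type*} (A : Set σ)
    (p : MvPolynomial (Aᶜ : Set σ) K) : setOne K A (rename Subtype.val p) = p := by
  rw [setOne, aeval_rename]
  convert aeval_X_left_apply p
  ext1 i
  simp [dif_neg i.2]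

theorem setOne_eq_one_of_mem_varPowers {K : Type*} [Field K] {σ : Type*} {A : Set σ}
    {m : MvPolynomial σ K} (hm : m ∈ varPowers K A) : setOne K A m = 1 := by
  suffices varPowers K A ≤ MonoidHom.mker (setOne K A) from this hm
  refine Submonoid.closure_le.mpr ?_
  rintro _ ⟨i, hi, rfl⟩
  simp [setOne, hi, MonoidHom.mem_mker]

theorem exists_monomial_eq_rename_mul (K : Type*) [Field K] {σ : Type*} (A : Set σ) (d : σ →₀ ℕ) :
    ∃ m ∈ varPowers K A, monomial d 1 = rename Subtype.val (monomial (d.comapDomain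
      (Subtype.val : (Aᶜ : Set σ) → σ) Subtype.val_injective.injOn) 1) * m := by
  classical
  refine ⟨monomial (d.filter (· ∈ A)) 1, ?_, ?_⟩
  · rw [monomial_eq, C_1, one_mul]
    refine Submonoid.prod_mem _ fun i hi => Submonoid.pow_mem _ (Submonoid.subset_closure ?_) _
    rw [Finsupp.support_filter, Finset.mem_filter] at hi
    exact ⟨i, hi.2, rfl⟩
  · rw [rename_monomial, monomial_mul, one_mul]
    congr 1
    congr 1
    ext i
    rw [Finsupp.add_apply]
    by_cases hi : i ∈ A
    · rw [Finsupp.mapDomain_of_notMem_range _ _ (by simpa using hi),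
        Finsupp.filter_apply_pos _ _ hi, zero_add]
    · rw [Finsupp.filter_apply_neg _ _ hi, add_zero]
      exact (Finsupp.mapDomain_apply Subtype.val_injective (d.comapDomain
        (Subtype.val : (Aᶜ : Set σ) → σ) Subtype.val_injective.injOn) ⟨i, hi⟩).symm

theorem setOne_monomial {K : Type*} [Field K] {σ : Type*} (A : Set σ) (d : σ →₀ ℕ) :
    setOne K A (monomial d 1) =
      monomial (d.comapDomain (Subtype.val : (Aᶜ : Set σ) → σ) Subtype.val_injective.injOn) 1 := by
  obtain ⟨m, hm, h⟩ := exists_monomial_eq_rename_mul K A d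
  rw [h, map_mul, setOne_rename, setOne_eq_one_of_mem_varPowers hm, mul_one]

/-- For every ideal, extending to the ring in which the variables in `A` are inverted and
contracting is contained in setting these variables to `1`; for a monomial ideal both agree, since
a monomial differs from its image under `setOne` by a product of variables in `A`. -/
theorem IsMonomialIdeal.monomialLocalization_eq {K : Type*} [Field K] {σ : Type*} (A : Set σ)
    {I : Ideal (MvPolynomial σ K)} (hI : IsMonomialIdeal I) :
    monomialLocalization A I = I.map (setOne K A) := by
  classical
  have hunit : ∀ y : varPowers K A, IsUnit ((setOne K A).toRingHom (y : MvPolynomial σ K)) := by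
    intro y
    rw [AlgHom.toRingHom_eq_coe, RingHom.coe_coe, setOne_eq_one_of_mem_varPowers y.2]
    exact isUnit_one
  apply le_antisymm
  · intro p hp
    rw [monomialLocalization, Ideal.mem_comap] at hp
    have h := Ideal.mem_map_of_mem (IsLocalization.lift (S := Localization (varPowers K A)) hunit) hp
    rw [Ideal.map_map, IsLocalization.lift_comp, RingHom.comp_apply, IsLocalization.lift_eq] at h
    change setOne K A (rename Subtype.val p) ∈ _ at h
    rwa [setOne_rename] at h
  · obtain ⟨s, rfl⟩ := hI
    rw [Ideal.map_le_iff_le_comap, Ideal.span_le]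
    rintro _ ⟨d, hd, rfl⟩
    obtain ⟨m, hm, h⟩ := exists_monomial_eq_rename_mul K A d
    have h1 := Ideal.mem_map_of_mem (algebraMap _ (Localization (varPowers K A)))
      (Ideal.subset_span (Set.mem_image_of_mem (fun d => monomial d (1 : K)) hd))
    change algebraMap _ _ (monomial d 1) ∈ _ at h1
    rw [h, map_mul, Ideal.mul_unit_mem_iff_mem _
      (IsLocalization.map_units (Localization (varPowers K A)) (⟨m, hm⟩ : varPowers K A))] at h1
    change setOne K A (monomial d 1) ∈ monomialLocalization A _
    rw [setOne_monomial]
    exact h1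

theorem IsMonomialIdeal.map_setOne {K : Type*} [Field K] {σ : Type*} (A : Set σ)
    {I : Ideal (MvPolynomial σ K)} (hI : IsMonomialIdeal I) :
    IsMonomialIdeal (I.map (setOne K A)) :=
  hI.map _ _ (setOne_monomial A)

/-! ### The ideal `𝔫 I` in one more variable -/

/-- The variables other than the additional variable `none`. -/
def equivComplNone (σ : Type*) : σ ≃ ({none}ᶜ : Set (Option σ)) where
  toFun i := ⟨some i, by simp⟩
  invFun j := j.1.get (Option.ne_none_iff_isSome.mp j.2)
  left_inv _ := by simp
  right_inv _ := by simp

/-- The ideal `𝔫 I` of `S[Y]`, where `𝔫` is generated by all variables, including `Y = X none`. -/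
noncomputable def varsMul {K : Type*} [Field K] {σ : Type*} (I : Ideal (MvPolynomial σ K)) :
    Ideal (MvPolynomial (Option σ) K) :=
  idealOfVars (Option σ) K * I.map (rename (R := K) some)

theorem IsMonomialIdeal.map_rename_some {K : Type*} [Field K] {σ : Type*}
    {I : Ideal (MvPolynomial σ K)} (hI : IsMonomialIdeal I) :
    IsMonomialIdeal (I.map (rename (R := K) some)) :=
  hI.map _ (Finsupp.mapDomain some) fun _ => rename_monomial _ _ _

theorem IsMonomialIdeal.varsMul {K : Type*} [Field K] {σ : Type*} {I : Ideal (MvPolynomial σ K)}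
    (hI : IsMonomialIdeal I) : IsMonomialIdeal (varsMul I) :=
  (isMonomialIdeal_idealOfVars K _).mul hI.map_rename_some

/-- Setting `Y = 1` turns `𝔫` into the unit ideal and gives back `I`. -/
theorem map_setOne_varsMul {K : Type*} [Field K] {σ : Type*} (I : Ideal (MvPolynomial σ K)) :
    (varsMul I).map (setOne K {none}) = I.map (rename (R := K) (equivComplNone σ)) := by
  have h1 : (idealOfVars (Option σ) K).map (setOne K {none}) = ⊤ := by
    rw [Ideal.eq_top_iff_one]
    have := Ideal.mem_map_of_mem (setOne K {none})
      (Ideal.subset_span (Set.mem_range_self none) : X none ∈ idealOfVars (Option σ) K)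
    simpa [setOne] using this
  have h2 : (setOne K ({none} : Set (Option σ))).comp (rename some) =
      rename (equivComplNone σ) := by
    ext1 i
    simp [setOne, equivComplNone]
  rw [varsMul, Ideal.map_mul, h1, Ideal.top_mul, ← h2]
  exact Ideal.map_map _ _

theorem IsMonomialIdeal.exists_socle_varsMul {K : Type*} [Field K] {σ : Type*}
    {I : Ideal (MvPolynomial σ K)} (hI : IsMonomialIdeal I) (h0 : I ≠ ⊥) :
    ∃ f, f ∉ StanleyConj.varsMul I ∧
      ∀ a ∈ idealOfVars (Option σ) K, a * f ∈ StanleyConj.varsMul I := by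
  refine hI.map_rename_some.exists_socle fun h => h0 ?_
  rwa [Ideal.map_eq_bot_iff_of_injective (rename_injective _ (Option.some_injective σ))] at h

theorem IsMonomialIdeal.holdsForQuotient_varsMul {K : Type*} [Field K] {σ : Type*}
    {I : Ideal (MvPolynomial σ K)} (hI : IsMonomialIdeal I) (h0 : I ≠ ⊥) :
    HoldsForQuotient (StanleyConj.varsMul I) := by
  obtain ⟨f, hf, hfJ⟩ := hI.exists_socle_varsMul h0
  rw [HoldsForQuotient, depth_quotient_eq_zero hf hfJ]
  exact zero_le

theorem IsMonomialIdeal.holdsForIdeal_varsMul {K : Type*} [Field K] {σ : Type*} [Finite σ]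
    {I : Ideal (MvPolynomial σ K)} (hI : IsMonomialIdeal I) (h0 : I ≠ ⊥) :
    HoldsForIdeal (StanleyConj.varsMul I) := by
  obtain ⟨f, hf, hfJ⟩ := hI.exists_socle_varsMul h0
  exact (depth_ideal_le_one hf hfJ).trans hI.varsMul.one_le_stanleyDepth

theorem holdsForQuotient_bot (K : Type*) [Field K] (σ : Type*) [Finite σ] :
    HoldsForQuotient (⊥ : Ideal (MvPolynomial σ K)) :=
  (depth_le_card K σ _).trans (card_le_stanleyDepth_quotient_bot K σ)

/-- The zero module has no regular sequences, so its depth is `0` here. -/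
theorem holdsForIdeal_bot (K : Type*) [Field K] (σ : Type*) :
    HoldsForIdeal (⊥ : Ideal (MvPolynomial σ K)) := by
  refine iSup_le fun rs => iSup_le fun _ => iSup_le fun h => ?_
  exact absurd h.nontrivial (not_nontrivial_iff_subsingleton.mpr inferInstance)

end StanleyConj

theorem mainTheorem8 (K : Type*) [Field K] :
    ((∀ (σ : Type) [Finite σ] (I : Ideal (MvPolynomial σ K)),
        StanleyConj.IsMonomialIdeal I → StanleyConj.HoldsForQuotient I) ↔
      (∀ (σ : Type) [Finite σ] (I : Ideal (MvPolynomial σ K)),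
        StanleyConj.IsMonomialIdeal I → StanleyConj.HoldsForQuotient I →
          ∀ A : Set σ, StanleyConj.HoldsForQuotient (StanleyConj.monomialLocalization A I))) ∧
    ((∀ (σ : Type) [Finite σ] (I : Ideal (MvPolynomial σ K)),
        StanleyConj.IsMonomialIdeal I → StanleyConj.HoldsForIdeal I) ↔
      (∀ (σ : Type) [Finite σ] (I : Ideal (MvPolynomial σ K)),
        StanleyConj.IsMonomialIdeal I → StanleyConj.HoldsForIdeal I →
          ∀ A : Set σ, StanleyConj.HoldsForIdeal (I.map (StanleyConj.setOne K A)))) := by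
  refine ⟨⟨fun h σ _ I hI _ A => ?_, fun h σ _ I hI => ?_⟩,
    ⟨fun h σ _ I hI _ A => h _ _ (hI.map_setOne A), fun h σ _ I hI => ?_⟩⟩
  · rw [hI.monomialLocalization_eq A]
    exact h _ _ (hI.map_setOne A)
  · by_cases h0 : I = ⊥
    · exact h0 ▸ StanleyConj.holdsForQuotient_bot K σ
    · have := h _ _ hI.varsMul (hI.holdsForQuotient_varsMul h0) {none}
      rw [hI.varsMul.monomialLocalization_eq, StanleyConj.map_setOne_varsMul] at this
      exact this.of_map_rename
  · by_cases h0 : I = ⊥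
    · exact h0 ▸ StanleyConj.holdsForIdeal_bot K σ
    · have := h _ _ hI.varsMul (hI.holdsForIdeal_varsMul h0) {none}
      rw [StanleyConj.map_setOne_varsMul] at this
      exact this.of_map_rename
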